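/- Let $\mathbb K$ be a field of characteristic $0$, $R=\mathbb K[x_1,\dots,x_n]$, and let $\mathcal S_d$ be the space of homogeneous polynomials of degree $d$ in $x_0,\dots,x_n$. Write $R^*=\mathrm{Hom}_{\mathbb K}(R,\mathbb K)$, identified with $\mathbb K[[z_1,\dots,z_n]]$ via $\varphi\mapsto\sum_{\alpha}\varphi(x^\alpha)\,z^\alpha/\alpha!$, and let $p\star\varphi\in R^*$ be the functional $q\mapsto\varphi(pq)$. Let $f\in\mathcal S_d$ have a generalized additive decomposition $f=\sum_{i=1}^s\omega_i\,\ell_i^{\,d-k_i}$, i.e. $0\le k_i\le d$, $\omega_i$ is homogeneous of degree $k_i$, the linear forms $\ell_i$ are pairwise non-proportional, and $\ell_i\nmid\omega_i$; assume moreover that $\ell_i=x_0+\xi_{i,1}x_1+\dots+\xi_{i,n}x_n$ with $\xi_i\in\mathbb K^n$. Write uniquely $\omega_i=\sum_{j=0}^{k_i}\omega_{i,j}\,\ell_i^{\,k_i-j}$ with $\omega_{i,j}\in\mathbb K[x_1,\dots,x_n]$ homogeneous of degree $j$, and put $$\omega_i^{d,\ell_i,x}:=\frac1{d!}\sum_{j=0}^{k_i}(d-j)!\,\omega_{i,j}\in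 R .$$ For $\omega\in R$ let $\langle\langle\omega\rangle\rangle:=\langle g(\partial_x)(\omega)\mid g\in R\rangle$ be its inverse system. Put $$\varphi:=\sum_{i=1}^s\omega_i^{d,\ell_i,x}(z)\,e^{\xi_{i,1}z_1+\dots+\xi_{i,n}z_n}\in R^*,\qquad I_\varphi:=\{p\in R\mid p\star\varphi=0\},\qquad \mathcal A_\varphi:=R/I_\varphi ,$$ and let $I_\varphi^\perp:=\{\psi\in R^*\mid\psi(p)=0\ \text{for all } p\in I_\varphi\}$. Let $\check f$ be the linear functional on $R_{\le d}$ (polynomials of degree $\le d$) given by $\check f(p)=\langle f,\,x_0^d\,p(x_1/x_0,\dots,x_n/x_0)\rangle_d$, where $\langle g,h\rangle_d=\sum_{|\alpha|=d}\binom d\alpha^{-1}g_\alpha h_\alpha$ is the apolar product of forms of degree $d$. For $c\le d$ and finite families $w=(w_i)$ in $R_{\le d-c}$ and $v=(v_j)$ in $R_{\le c}$, let $H_{\check f}^{w,v}:=(\check f(w_iv_j))_{i,j}$; for subspaces $V\subseteq R_{\le c}$, $W\subseteq R_{\le d-c}$ let $\mathbf H_{\check f}^{W,V}:V\to W^*$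 be the map $p\mapsto(q\mapsto\check f(pq))$. For $B\subseteq R$ let $B^+:=B\cup x_1B\cup\dots\cup x_nB$. **Theorem.** Let $B$ and $B'$ be finite families in $R$ whose classes are bases of $\mathcal A_\varphi$, with $1\in B$. Let $c\le d$ and let $A,A'$ be finite linearly independent families in $R$ with $B^+\subseteq\langle A\rangle\subseteq R_{\le c}$ and $B'\subseteq\langle A'\rangle\subseteq R_{\le d-c}$. Let $\mathbf H:=\mathbf H_{\check f}^{\langle A'\rangle,\langle A\rangle}$, and let $H:=H_{\check f}^{A',A}$ be its matrix. Then: 1. $H_0:=H_{\check f}^{B',B}$ is invertible. 2. $\operatorname{rank}H=\dim_{\mathbb K}\mathcal A_\varphi=\sum_{i=1}^s\dim_{\mathbb K}\langle\langle\omega_i^{d,\ell_i,x}\rangle\rangle$. 3. For every $1\le i\le n$, with $H_i:=H_{\check f}^{B',x_iB}$, the matrix $H_0^{-1}H_i$ is the matrix of multiplication by $x_i$ on $\mathcal A_\varphi$ in the basis $B$. 4. $\ker\mathbf H=I_\varphi\cap\langle A\rangle$; the ideal of $R$ generated by $\ker\mathbf H$ is $I_\varphi$; and $\operatorname{im}\mathbf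 H=\{\psi|_{\langle A'\rangle}\mid\psi\in I_\varphi^\perp\}$. -/

import Mathlib

open MvPolynomial Module
open scoped Nat

noncomputable section

namespace GAD

/-! ### Polynomials of bounded degree, apolarity, homogenization -/

section Apolarity

variable {K : Type*} [Field K]

/-- The space `R_{≤ d}` of polynomials of total degree at most `d` in `x₁, …, xₙ`. -/
abbrev degLE (K : Type*) [Field K] (n d : ℕ) : Submodule K (MvPolynomial (Fin n) K) :=
  restrictTotalDegree (Fin n) K d

/-- The space `S_d` of homogeneous polynomials of degree `d` in `x₀, …, xₙ`. -/
abbrev forms (K : Type*) [Field K] (n d : ℕ) : Submodule K (MvPolynomial (Fin (n + 1)) K) :=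
  homogeneousSubmodule (Fin (n + 1)) K d

/-- The linear form `(ξ, x) = ∑ ξᵢ xᵢ`. -/
def linearForm {m : ℕ} (ξ : Fin m → K) : MvPolynomial (Fin m) K :=
  ∑ i, C (ξ i) * X i

/-- The apolar product `∑_α (d choose α)⁻¹ f_α g_α` of two forms of degree `d`, where
`d choose α = d! / α!` is the multinomial coefficient. -/
def apolar {m : ℕ} (f g : MvPolynomial (Fin m) K) : K :=
  ∑ α ∈ f.support, ((α.multinomial : ℕ) : K)⁻¹ * coeff α f * coeff α g

/-- The functional `f^* = ⟨f, ·⟩` on `S_d` attached to `f ∈ S_d` by the apolar product. -/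
def apolarDual {n d : ℕ} (f : forms K n d) : Dual K (forms K n d) where
  toFun g := apolar (f : MvPolynomial (Fin (n + 1)) K) g
  map_add' g h := by
    simp [apolar, mul_add, Finset.sum_add_distrib]
  map_smul' a g := by
    simp only [apolar, SetLike.val_smul, coeff_smul, smul_eq_mul, RingHom.id_apply,
      Finset.mul_sum]
    exact Finset.sum_congr rfl fun _ _ => by ring

/-- The linear map with `x^β ↦ x₀^(d - |β|) x^β` on monomials. Only its values on polynomials of
degree at most `d` matter. -/
def homogenizeAux (K : Type*) [Field K] (n d : ℕ) :
    MvPolynomial (Fin n) K →ₗ[K] MvPolynomial (Fin (n + 1)) K :=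
  (basisMonomials (Fin n) K).constr K
    fun β => monomial (Finsupp.cons (d - β.degree) β) (1 : K)

theorem homogenizeAux_mem {n d : ℕ} (p : MvPolynomial (Fin n) K) (hp : p ∈ degLE K n d) :
    homogenizeAux K n d p ∈ forms K n d := by
  rw [mem_restrictTotalDegree] at hp
  have h : homogenizeAux K n d p =
      ∑ β ∈ p.support, coeff β p • monomial (Finsupp.cons (d - β.degree) β) (1 : K) := by
    conv_lhs => rw [p.as_sum, map_sum]
    refine Finset.sum_congr rfl fun β _ => ?_
    have : monomial β (coeff β p) = coeff β p • basisMonomials (Fin n) K β := by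
      simp [smul_monomial]
    rw [this, map_smul, homogenizeAux, Basis.constr_basis]
  rw [h]
  refine Submodule.sum_mem _ fun β hβ => Submodule.smul_mem _ _ ?_
  rw [mem_homogeneousSubmodule]
  apply isHomogeneous_monomial
  have h1 : β.degree ≤ d := by
    refine le_trans ?_ hp
    have := le_totalDegree hβ
    simpa [Finsupp.degree_apply, Finsupp.sum] using this
  have h2 : (Finsupp.cons (d - β.degree) β).degree = (d - β.degree) + β.degree := by
    rw [Finsupp.degree_eq_sum, Finsupp.degree_eq_sum, Fin.sum_univ_succ]
    simp
  rw [h2]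
  omega

/-- The degree-`d` homogenization map `𝔥₀ : R_{≤ d} → S_d`, `p ↦ x₀^d p(x₁/x₀, …, xₙ/x₀)`. -/
def homogenization (K : Type*) [Field K] (n d : ℕ) : degLE K n d →ₗ[K] forms K n d :=
  (homogenizeAux K n d).restrict homogenizeAux_mem

/-- The functional `f̌ = f^* ∘ 𝔥₀` on `R_{≤ d}`. -/
def fcheck {n d : ℕ} (f : forms K n d) : Dual K (degLE K n d) :=
  apolarDual f ∘ₗ homogenization K n d

end Apolarity

/-! ### Generalized additive decompositions -/

section Decomposition

variable {K : Type*} [Field K]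

/-- `f = ∑ᵢ ωᵢ ℓᵢ^(d - kᵢ)` is a generalized additive decomposition of `f ∈ S_d`: `0 ≤ kᵢ ≤ d`,
`ωᵢ` is homogeneous of degree `kᵢ`, the linear forms `ℓᵢ = (ξᵢ, x)` are pairwise not proportional,
and `ℓᵢ` does not divide `ωᵢ`. -/
structure IsGAD {n d s : ℕ} (f : forms K n d) (k : Fin s → ℕ)
    (ω : Fin s → MvPolynomial (Fin (n + 1)) K) (ξ : Fin s → Fin (n + 1) → K) : Prop where
  le : ∀ i, k i ≤ d
  homogeneous : ∀ i, (ω i).IsHomogeneous (k i)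
  not_proportional : ∀ i j, i ≠ j → LinearIndependent K ![linearForm (ξ i), linearForm (ξ j)]
  not_dvd : ∀ i, ¬ linearForm (ξ i) ∣ ω i
  eq_sum : (f : MvPolynomial (Fin (n + 1)) K) = ∑ i, ω i * linearForm (ξ i) ^ (d - k i)

/-- The linear form `∑_{i ≥ 1} ξᵢ xᵢ`, i.e. the form `(ξ, x)` without its `x₀`-term. -/
def tailForm {n : ℕ} (ξ : Fin (n + 1) → K) : MvPolynomial (Fin (n + 1)) K :=
  ∑ i : Fin n, C (ξ i.succ) * X i.succ

/-- Rewriting in the coordinates `ℓ, x₁, …, xₙ`, where `ℓ = (ξ, x)` and `ξ₀ ≠ 0`: the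
substitution `x₀ ↦ (x₀ - ∑_{i ≥ 1} ξᵢ xᵢ) / ξ₀`, after which `x₀` stands for `ℓ`. -/
def toCoords {n : ℕ} (ξ : Fin (n + 1) → K) :
    MvPolynomial (Fin (n + 1)) K →ₐ[K] MvPolynomial (Fin (n + 1)) K :=
  aeval (Fin.cons (C (ξ 0)⁻¹ * (X 0 - tailForm ξ)) fun i => X i.succ)

/-- The component `ωⱼ ∈ K[x₁, …, xₙ]_j` in the decomposition
`ω = ∑_{j ≤ k} ωⱼ ℓ^(k - j)` of a form `ω` of degree `k` with respect to `ℓ = (ξ, x)`, `ξ₀ ≠ 0`,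
and `x₁, …, xₙ`: the coefficient of `ℓ^(k - j)` in the coordinates `ℓ, x₁, …, xₙ`.
See `part_spec` and `part_unique`. -/
def part {n : ℕ} (k : ℕ) (ξ : Fin (n + 1) → K) (ω : MvPolynomial (Fin (n + 1)) K) (j : ℕ) :
    MvPolynomial (Fin n) K :=
  (finSuccEquiv K n (toCoords ξ ω)).coeff (k - j)

theorem aeval_cons_rename {n : ℕ} (a : MvPolynomial (Fin (n + 1)) K) (p : MvPolynomial (Fin n) K) :
    aeval (Fin.cons a fun i => X i.succ : Fin (n + 1) → MvPolynomial (Fin (n + 1)) K)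
      (rename Fin.succ p) = rename Fin.succ p := by
  induction p using MvPolynomial.induction_on with
  | C r => simp
  | add p q hp hq => simp only [map_add, hp, hq]
  | mul_X p i hp => simp only [map_mul, hp, rename_X, aeval_X, Fin.cons_succ]

theorem finSuccEquiv_rename_succ {n : ℕ} (p : MvPolynomial (Fin n) K) :
    finSuccEquiv K n (rename Fin.succ p) = Polynomial.C p := by
  induction p using MvPolynomial.induction_on with
  | C r => simp [finSuccEquiv_apply]
  | add p q hp hq => simp only [map_add, hp, hq]
  | mul_X p i hp => simp only [map_mul, hp, rename_X, finSuccEquiv_X_succ]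

theorem linearForm_eq {n : ℕ} (ξ : Fin (n + 1) → K) :
    linearForm ξ = C (ξ 0) * X 0 + tailForm ξ := by
  rw [linearForm, tailForm, Fin.sum_univ_succ]

theorem toCoords_rename {n : ℕ} (ξ : Fin (n + 1) → K) (p : MvPolynomial (Fin n) K) :
    toCoords ξ (rename Fin.succ p) = rename Fin.succ p := by
  exact aeval_cons_rename _ p

theorem toCoords_linearForm {n : ℕ} (ξ : Fin (n + 1) → K) (h : ξ 0 ≠ 0) :
    toCoords ξ (linearForm ξ) = X 0 := by
  have h1 : tailForm ξ = rename Fin.succ (∑ i : Fin n, C (ξ i.succ) * X i) := by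
    simp [tailForm]
  have h2 : toCoords ξ (tailForm ξ) = tailForm ξ := by rw [h1, toCoords_rename]
  have h3 : (C (ξ 0) * C (ξ 0)⁻¹ : MvPolynomial (Fin (n + 1)) K) = 1 := by
    rw [← C_mul, mul_inv_cancel₀ h, C_1]
  rw [linearForm_eq, map_add, h2, map_mul, algHom_C, algebraMap_eq]
  have h4 : toCoords ξ (X 0) = C (ξ 0)⁻¹ * (X 0 - tailForm ξ) := by simp [toCoords]
  rw [h4, ← mul_assoc, h3]
  ring

/-- The components `part k ξ ω j` are homogeneous of degree `j` and decompose `ω`. -/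
theorem part_spec {n k : ℕ} (ξ : Fin (n + 1) → K) (h : ξ 0 ≠ 0)
    (ω : MvPolynomial (Fin (n + 1)) K) (hω : ω.IsHomogeneous k) :
    (∀ j ≤ k, (part k ξ ω j).IsHomogeneous j) ∧
      ω = ∑ j ∈ Finset.range (k + 1),
        rename Fin.succ (part k ξ ω j) * linearForm ξ ^ (k - j) := by
  have htail : (tailForm ξ).IsHomogeneous 1 :=
    IsHomogeneous.sum _ _ _ fun i _ => isHomogeneous_C_mul_X _ _
  have hhom : (toCoords ξ ω).IsHomogeneous k := by
    have := hω.aeval (Fin.cons (C (ξ 0)⁻¹ * (X 0 - tailForm ξ)) fun i => X i.succ) (n := 1) (by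
      intro i
      refine Fin.cases ?_ (fun i => ?_) i
      · simpa using ((isHomogeneous_X K (0 : Fin (n + 1))).sub htail).C_mul (ξ 0)⁻¹
      · simpa using isHomogeneous_X K i.succ)
    simpa [toCoords] using this
  constructor
  · intro j hj
    exact IsHomogeneous.finSuccEquiv_coeff_isHomogeneous hhom _ _ (by omega)
  · -- the inverse substitution `x₀ ↦ ℓ`
    let Ψ : MvPolynomial (Fin (n + 1)) K →ₐ[K] MvPolynomial (Fin (n + 1)) K :=
      aeval (Fin.cons (linearForm ξ) fun i => X i.succ)
    have hΨr : ∀ p : MvPolynomial (Fin n) K, Ψ (rename Fin.succ p) = rename Fin.succ p := by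
      exact fun p => aeval_cons_rename _ p
    have hΨ0 : Ψ (X 0) = linearForm ξ := by simp [Ψ]
    have hΨt : Ψ (tailForm ξ) = tailForm ξ := by
      have h1 : tailForm ξ = rename Fin.succ (∑ i : Fin n, C (ξ i.succ) * X i) := by
        simp [tailForm]
      rw [h1, hΨr]
    have hinv : Ψ.comp (toCoords ξ) = AlgHom.id K _ := by
      apply algHom_ext
      intro i
      refine Fin.cases ?_ (fun i => ?_) i
      · have h4 : toCoords ξ (X 0) = C (ξ 0)⁻¹ * (X 0 - tailForm ξ) := by simp [toCoords]
        rw [AlgHom.comp_apply, h4, map_mul, map_sub, hΨ0, hΨt, algHom_C, algebraMap_eq,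
          linearForm_eq, add_sub_cancel_right, ← mul_assoc, ← C_mul, inv_mul_cancel₀ h, C_1,
          one_mul]
        rfl
      · simp [toCoords, Ψ]
    have hdeg : (finSuccEquiv K n (toCoords ξ ω)).natDegree < k + 1 := by
      rw [natDegree_finSuccEquiv]
      exact Nat.lt_succ_of_le ((degreeOf_le_totalDegree _ _).trans hhom.totalDegree_le)
    have hsum : toCoords ξ ω = ∑ j ∈ Finset.range (k + 1),
        rename Fin.succ ((finSuccEquiv K n (toCoords ξ ω)).coeff j) * X 0 ^ j := by
      apply (finSuccEquiv K n).injective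
      conv_lhs => rw [Polynomial.as_sum_range' _ _ hdeg]
      rw [map_sum]
      refine Finset.sum_congr rfl fun j _ => ?_
      rw [map_mul, map_pow, finSuccEquiv_X_zero, finSuccEquiv_rename_succ,
        Polynomial.C_mul_X_pow_eq_monomial]
    have hω' : ω = Ψ (toCoords ξ ω) := by
      rw [← AlgHom.comp_apply, hinv]; rfl
    conv_lhs => rw [hω', hsum, map_sum]
    rw [← Finset.sum_range_reflect]
    refine Finset.sum_congr rfl fun j hj => ?_
    rw [map_mul, map_pow, hΨr, hΨ0, part]
    rfl

/-- The decomposition in `part_spec` is unique. -/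
theorem part_unique {n k : ℕ} (ξ : Fin (n + 1) → K) (h : ξ 0 ≠ 0)
    (ω : MvPolynomial (Fin (n + 1)) K) (q : ℕ → MvPolynomial (Fin n) K)
    (hq : ω = ∑ j ∈ Finset.range (k + 1), rename Fin.succ (q j) * linearForm ξ ^ (k - j)) :
    ∀ j ≤ k, part k ξ ω j = q j := by
  intro j hj
  have h1 : finSuccEquiv K n (toCoords ξ ω) = ∑ i ∈ Finset.range (k + 1),
      Polynomial.C (q i) * Polynomial.X ^ (k - i) := by
    rw [hq, map_sum, map_sum]
    refine Finset.sum_congr rfl fun i _ => ?_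
    rw [map_mul, map_pow, toCoords_rename, toCoords_linearForm ξ h, map_mul, map_pow,
      finSuccEquiv_X_zero, finSuccEquiv_rename_succ]
  rw [part, h1, Polynomial.finsetSum_coeff, Finset.sum_eq_single j]
  · simp
  · intro i hi hij
    rw [Finset.mem_range] at hi
    rw [Polynomial.coeff_C_mul_X_pow, if_neg (by omega)]
  · intro hj'
    rw [Finset.mem_range] at hj'
    omega

/-- The polynomial `ω^{d,ℓ,x} = (1/d!) ∑_{j ≤ k} (d - j)! ωⱼ` in `x₁, …, xₙ` attached to a form `ω`
of degree `k ≤ d` and to `ℓ = (ξ, x)` with `ξ₀ ≠ 0`. -/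
def affinePart {n : ℕ} (d k : ℕ) (ξ : Fin (n + 1) → K) (ω : MvPolynomial (Fin (n + 1)) K) :
    MvPolynomial (Fin n) K :=
  (d ! : K)⁻¹ • ∑ j ∈ Finset.range (k + 1), ((d - j)! : K) • part k ξ ω j

end Decomposition

/-! ### Duality, inverse systems and Hankel operators -/

section Duality

variable {K : Type*} [Field K] {n : ℕ}

/-- The iterated derivative `∂^α = ∂₁^α₁ ⋯ ∂ₙ^αₙ`. -/
def iterPDeriv (α : Fin n →₀ ℕ) : End K (MvPolynomial (Fin n) K) :=
  (List.ofFn fun i => (pderiv (R := K) i).toLinearMap ^ α i).prod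

/-- The differential operator `g(∂)` applied to `p`. -/
def diffOp (g p : MvPolynomial (Fin n) K) : MvPolynomial (Fin n) K :=
  ∑ α ∈ g.support, coeff α g • iterPDeriv α p

/-- The inverse system `⟨g(∂)(ω) | g ∈ R⟩` of a polynomial `ω`. -/
def invSystem (ω : MvPolynomial (Fin n) K) : Submodule K (MvPolynomial (Fin n) K) :=
  Submodule.span K (Set.range fun g => diffOp g ω)

/-- The linear functional on `R` represented by the series `Φ(z) ∈ K[[z]]`: the one with
`Φ(z) = ∑_α Φ(x^α) z^α / α!`, i.e. with value `α! · [z^α] Φ(z)` on the monomial `x^α`. -/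
def functionalOf (g : MvPowerSeries (Fin n) K) : Dual K (MvPolynomial (Fin n) K) :=
  (basisMonomials (Fin n) K).constr K fun α => ((∏ i, (α i)! : ℕ) : K) * MvPowerSeries.coeff α g

/-- The exponential series `e_ξ(z) = ∑_α ξ^α z^α / α!`. -/
def expSeries (ξ : Fin n → K) : MvPowerSeries (Fin n) K :=
  fun α => (∏ i, ξ i ^ α i) / ((∏ i, (α i)! : ℕ) : K)

/-- The linear functional `Φ = ∑ᵢ ωᵢ^{d,ℓᵢ,x}(z) e_{ξᵢ}(z)` on `R` associated with the generalized
additive decomposition `∑ᵢ ωᵢ ℓᵢ^(d - kᵢ)`, where `ℓᵢ = x₀ + ξ_{i,1} x₁ + ⋯ + ξ_{i,n} xₙ`. -/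
def gadFunctional {s : ℕ} (d : ℕ) (k : Fin s → ℕ) (ω : Fin s → MvPolynomial (Fin (n + 1)) K)
    (ξ : Fin s → Fin (n + 1) → K) : Dual K (MvPolynomial (Fin n) K) :=
  functionalOf (∑ i, (affinePart d (k i) (ξ i) (ω i) : MvPowerSeries (Fin n) K) *
    expSeries fun j => ξ i j.succ)

/-- The co-product `p ⋆ Φ : q ↦ Φ(p q)`. -/
def coproduct (p : MvPolynomial (Fin n) K) (Φ : Dual K (MvPolynomial (Fin n) K)) :
    Dual K (MvPolynomial (Fin n) K) :=
  Φ ∘ₗ LinearMap.mulLeft K p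

/-- The annihilator `I_Φ = {p ∈ R | p ⋆ Φ = 0}`, an ideal of `R`. -/
def annIdeal (Φ : Dual K (MvPolynomial (Fin n) K)) : Ideal (MvPolynomial (Fin n) K) where
  carrier := {p | coproduct p Φ = 0}
  zero_mem' := by
    ext q
    simp [coproduct]
  add_mem' {p q} hp hq := by
    refine LinearMap.ext fun r => ?_
    have h1 : Φ (p * r) = 0 := LinearMap.congr_fun hp r
    have h2 : Φ (q * r) = 0 := LinearMap.congr_fun hq r
    simp [coproduct, add_mul, h1, h2]
  smul_mem' a p hp := by
    refine LinearMap.ext fun r => ?_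
    have h1 : Φ (p * (a * r)) = 0 := LinearMap.congr_fun hp (a * r)
    simp [coproduct, mul_left_comm a p, h1]

/-- The orthogonal `I^⊥ = {ψ ∈ R^* | ψ(p) = 0 for all p ∈ I}` of an ideal. -/
def perp (I : Ideal (MvPolynomial (Fin n) K)) : Submodule K (Dual K (MvPolynomial (Fin n) K)) :=
  (I.restrictScalars K).dualAnnihilator

/-- The polynomials `b j` form a basis of the quotient algebra `R / I`. -/
def IsBasisMod (I : Ideal (MvPolynomial (Fin n) K)) {ι : Type*}
    (b : ι → MvPolynomial (Fin n) K) : Prop :=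
  LinearIndependent K (fun j => Ideal.Quotient.mk I (b j)) ∧
    Submodule.span K (Set.range fun j => Ideal.Quotient.mk I (b j)) = ⊤

/-- The basis of `R / I` given by the classes of the `b j`. -/
def IsBasisMod.basis {I : Ideal (MvPolynomial (Fin n) K)} {ι : Type*}
    {b : ι → MvPolynomial (Fin n) K} (h : IsBasisMod I b) :
    Basis ι K (MvPolynomial (Fin n) K ⧸ I) :=
  Basis.mk h.1 h.2.ge

/-- The operator of multiplication by (the class of) `q` on `R / I`. -/
def multOp (I : Ideal (MvPolynomial (Fin n) K)) (q : MvPolynomial (Fin n) K) :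
    End K (MvPolynomial (Fin n) K ⧸ I) :=
  LinearMap.mulLeft K (Ideal.Quotient.mk I q)

/-- `B⁺ = B ∪ x₁ B ∪ ⋯ ∪ xₙ B`. -/
def plus (B : Set (MvPolynomial (Fin n) K)) : Set (MvPolynomial (Fin n) K) :=
  B ∪ ⋃ k : Fin n, (fun p => X k * p) '' B

theorem subset_plus {B : Set (MvPolynomial (Fin n) K)} {p : MvPolynomial (Fin n) K} (hp : p ∈ B) :
    p ∈ plus B :=
  Or.inl hp

theorem X_mul_mem_plus {B : Set (MvPolynomial (Fin n) K)} {p : MvPolynomial (Fin n) K} (hp : p ∈ B)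
    (k : Fin n) : X k * p ∈ plus B :=
  Or.inr (Set.mem_iUnion.2 ⟨k, p, hp, rfl⟩)

theorem mul_mem_degLE {c d : ℕ} (hc : c ≤ d) {p q : MvPolynomial (Fin n) K}
    (hp : p ∈ degLE K n c) (hq : q ∈ degLE K n (d - c)) : p * q ∈ degLE K n d := by
  rw [mem_restrictTotalDegree] at *
  have := totalDegree_mul p q
  omega

/-- The truncated Hankel operator `H_Φ^{W,V} : V → W^*`, `p ↦ (p ⋆ Φ)|_W = (q ↦ Φ(p q))`, for a
functional `Φ` on `R_{≤ d}` and subspaces `V ⊆ R_{≤ c}` and `W ⊆ R_{≤ d - c}`. -/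
def hankel {c d : ℕ} (hc : c ≤ d) (Φ : Dual K (degLE K n d))
    (W V : Submodule K (MvPolynomial (Fin n) K)) (hW : W ≤ degLE K n (d - c))
    (hV : V ≤ degLE K n c) : V →ₗ[K] Dual K W :=
  LinearMap.mk₂ K
    (fun p q => Φ ⟨(p : MvPolynomial (Fin n) K) * q, mul_mem_degLE hc (hV p.2) (hW q.2)⟩)
    (fun p p' q => by rw [← map_add]; congr 1; ext1; simp [add_mul])
    (fun a p q => by rw [← map_smul]; congr 1; ext1; simp)
    (fun p q q' => by rw [← map_add]; congr 1; ext1; simp [mul_add])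
    (fun a p q => by rw [← map_smul]; congr 1; ext1; simp)

/-- The Hankel matrix `H_Φ^{w,v} = (Φ(wᵢ vⱼ))_{i,j}` of families `v` in `R_{≤ c}` and `w` in
`R_{≤ d - c}`. -/
def hankelMatrix {c d : ℕ} (hc : c ≤ d) (Φ : Dual K (degLE K n d)) {ι κ : Type*}
    (w : κ → MvPolynomial (Fin n) K) (v : ι → MvPolynomial (Fin n) K)
    (hw : ∀ i, w i ∈ degLE K n (d - c)) (hv : ∀ j, v j ∈ degLE K n c) : Matrix κ ι K :=
  Matrix.of fun i j => Φ ⟨v j * w i, mul_mem_degLE hc (hv j) (hw i)⟩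

end Duality

end GAD

end
open GAD

/-!
A functional on `R = K[x₁, …, xₙ]` is the same as a power series, and `xⱼ ⋆ ·` is then `∂/∂zⱼ`
(`coproduct_X_functionalOf`). Hence on functionals `g(z) e_ξ(z)` with `g` a polynomial the operator
`xⱼ - ξⱼ` acts by differentiating `g`, so that `R ⋆ (g e_ξ) = ⟨⟨g⟩⟩ e_ξ`. As `e_ξ` is invertible,
the quotient of `R` by the annihilator of `g e_ξ` has the dimension of the inverse system of `g`
(`rank_quotient_annIdeal_expFunctional`). A power of each `xⱼ - ξⱼ` lies in that annihilator, so
annihilators at distinct points are coprime. The annihilator of `Φ = ∑ᵢ gᵢ e_{ξᵢ}` is therefore the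
intersection of those of the summands (`annIdeal_sum`), and the Chinese remainder theorem gives the
dimension of `A_Φ = R / I_Φ`.

The functional `f̌` is the restriction of `Φ` to `R_{≤ d}` (`fcheck_eq_gadFunctional`). By linearity
this is the case of a single summand `q ℓ^(d - j)` with `q` homogeneous of degree `j`, tested on a
monomial, where it is an identity of multinomial coefficients which accounts for the factor
`(d - j)! / d!`.

The rest is duality. The bilinear form `(p, q) ↦ Φ(p q)` on the finite-dimensional algebra `A_Φ` is
nondegenerate because `I_Φ` is the annihilator of `Φ`, so it is an isomorphism `A_Φ ≃ A_Φ^*`. The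
truncated Hankel operator on `V = ⟨A⟩` and `W = ⟨A'⟩` is the composition
`V → A_Φ ≃ A_Φ^* → W^*` (`hankel_eq_comp`) of a surjection, this isomorphism and an injection, which
gives its rank, kernel and image, and `H₀` is a matrix of the isomorphism itself. Finally, `I_Φ` is
generated by `I_Φ ∩ ⟨A⟩` because, modulo these elements, the span of `B` contains `1` and is stable
under multiplication by the variables (`IsBasisMod.span_inf_eq`).
-/

namespace GAD

/-! ### Functionals attached to power series -/

section Functional

variable {K : Type*} [Field K] {n : ℕ}

theorem functionalOf_monomial (G : MvPowerSeries (Fin n) K) (α : Fin n →₀ ℕ) (r : K) :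
    functionalOf G (monomial α r) =
      r * (((∏ i, (α i)! : ℕ) : K) * MvPowerSeries.coeff α G) := by
  have h : monomial α r = r • basisMonomials (Fin n) K α := by simp [smul_monomial]
  rw [h, map_smul, functionalOf, Basis.constr_basis, smul_eq_mul]

theorem functionalOf_add (G H : MvPowerSeries (Fin n) K) :
    functionalOf (G + H) = functionalOf G + functionalOf H := by
  refine (basisMonomials (Fin n) K).ext fun α => ?_
  simp [functionalOf_monomial, mul_add]

theorem functionalOf_smul (r : K) (G : MvPowerSeries (Fin n) K) :
    functionalOf (r • G) = r • functionalOf G := by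
  refine (basisMonomials (Fin n) K).ext fun α => ?_
  simp [functionalOf_monomial, mul_left_comm]

/-- In characteristic zero a power series is determined by its functional. -/
theorem functionalOf_injective [CharZero K] :
    Function.Injective (functionalOf : MvPowerSeries (Fin n) K → _) := by
  intro G H h
  ext α
  have h1 := LinearMap.congr_fun h (monomial α 1)
  rw [functionalOf_monomial, functionalOf_monomial, one_mul, one_mul] at h1
  refine mul_left_cancel₀ ?_ h1
  exact_mod_cast Finset.prod_ne_zero_iff.2 fun i _ => (α i).factorial_ne_zero

theorem prod_factorial_add_single (α : Fin n →₀ ℕ) (j : Fin n) :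
    ∏ i, ((α + Finsupp.single j 1 : Fin n →₀ ℕ) i)! = (α j + 1) * ∏ i, (α i)! := by
  rw [← Finset.mul_prod_erase _ _ (Finset.mem_univ j),
    ← Finset.mul_prod_erase Finset.univ (fun i => (α i)!) (Finset.mem_univ j), ← mul_assoc]
  congr 1
  · simp [Nat.factorial_succ]
  · refine Finset.prod_congr rfl fun i hi => ?_
    simp [Finset.ne_of_mem_erase hi]

@[simp]
theorem coproduct_apply (p q : MvPolynomial (Fin n) K) (Φ : Dual K (MvPolynomial (Fin n) K)) :
    coproduct p Φ q = Φ (p * q) := rfl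

theorem coproduct_one (Φ : Dual K (MvPolynomial (Fin n) K)) : coproduct 1 Φ = Φ :=
  LinearMap.ext fun q => by rw [coproduct_apply, one_mul]

theorem coproduct_mul (p q : MvPolynomial (Fin n) K) (Φ : Dual K (MvPolynomial (Fin n) K)) :
    coproduct (p * q) Φ = coproduct p (coproduct q Φ) := by
  refine LinearMap.ext fun r => ?_
  simp [mul_assoc, mul_left_comm q]

theorem mem_annIdeal {Φ : Dual K (MvPolynomial (Fin n) K)} {p : MvPolynomial (Fin n) K} :
    p ∈ annIdeal Φ ↔ coproduct p Φ = 0 := Iff.rfl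

theorem mem_annIdeal_iff {Φ : Dual K (MvPolynomial (Fin n) K)} {p : MvPolynomial (Fin n) K} :
    p ∈ annIdeal Φ ↔ ∀ q, Φ (p * q) = 0 := LinearMap.ext_iff

/-- Under the identification of functionals with power series, `xⱼ ⋆ ·` is `∂/∂zⱼ`. -/
theorem coproduct_X_functionalOf (j : Fin n) (G : MvPowerSeries (Fin n) K) :
    coproduct (X j) (functionalOf G) = functionalOf (MvPowerSeries.pderiv K j G) := by
  refine (basisMonomials (Fin n) K).ext fun α => ?_
  have h : (X j * monomial α 1 : MvPolynomial (Fin n) K) =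
      monomial (α + Finsupp.single j 1) 1 := by
    rw [X, monomial_mul, one_mul, add_comm]
  rw [coe_basisMonomials, coproduct_apply, h, functionalOf_monomial, functionalOf_monomial,
    prod_factorial_add_single, MvPowerSeries.coeff_pderiv]
  push_cast
  ring

/-! ### Polynomial-exponential functionals and inverse systems -/

theorem coeff_expSeries (ξ : Fin n → K) (α : Fin n →₀ ℕ) :
    MvPowerSeries.coeff α (expSeries ξ) = (∏ i, ξ i ^ α i) / ((∏ i, (α i)! : ℕ) : K) := rfl

theorem pderiv_expSeries [CharZero K] (ξ : Fin n → K) (j : Fin n) :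
    MvPowerSeries.pderiv K j (expSeries ξ) = ξ j • expSeries ξ := by
  ext α
  have h1 : ∏ i, ξ i ^ (α + Finsupp.single j 1 : Fin n →₀ ℕ) i = ξ j * ∏ i, ξ i ^ α i := by
    simp only [Finsupp.add_apply, pow_add, Finset.prod_mul_distrib]
    rw [mul_comm]
    congr 1
    rw [Finset.prod_eq_single j] <;> simp +contextual [eq_comm]
  have h2 : MvPowerSeries.coeff (α + Finsupp.single j 1) (expSeries ξ) =
      ξ j * (∏ i, ξ i ^ α i) / ((α j + 1 : K) * ((∏ i, (α i)! : ℕ) : K)) := by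
    rw [← h1, coeff_expSeries, prod_factorial_add_single]
    push_cast
    rfl
  have h4 : (α j + 1 : K) ≠ 0 := Nat.cast_add_one_ne_zero _
  rw [MvPowerSeries.coeff_pderiv, h2, MvPowerSeries.coeff_smul, coeff_expSeries]
  field_simp

theorem isUnit_expSeries (ξ : Fin n → K) : IsUnit (expSeries ξ) := by
  rw [MvPowerSeries.isUnit_iff_constantCoeff]
  have : MvPowerSeries.constantCoeff (expSeries ξ) = 1 := by
    rw [← MvPowerSeries.coeff_zero_eq_constantCoeff_apply]
    simp [coeff_expSeries]
  simp [this]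

/-- The functional with series `g(z) e_ξ(z)`, as a linear function of the polynomial `g`. -/
noncomputable def expFunctional (ξ : Fin n → K) :
    MvPolynomial (Fin n) K →ₗ[K] Dual K (MvPolynomial (Fin n) K) where
  toFun g := functionalOf ((g : MvPowerSeries (Fin n) K) * expSeries ξ)
  map_add' g h := by rw [MvPolynomial.coe_add, add_mul, functionalOf_add]
  map_smul' r g := by
    rw [MvPolynomial.coe_smul, smul_mul_assoc, functionalOf_smul, RingHom.id_apply]

theorem expFunctional_apply (ξ : Fin n → K) (g : MvPolynomial (Fin n) K) :
    expFunctional ξ g = functionalOf ((g : MvPowerSeries (Fin n) K) * expSeries ξ) := rfl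

theorem expFunctional_injective [CharZero K] (ξ : Fin n → K) :
    Function.Injective (expFunctional ξ) := by
  intro g h hgh
  have h1 := functionalOf_injective hgh
  exact MvPolynomial.coe_injective _ _ (isUnit_expSeries ξ |>.mul_right_cancel h1)

/-- The operator `xⱼ - ξⱼ` acts on `g(z) e_ξ(z)` by differentiating `g`. -/
theorem expFunctional_pderiv [CharZero K] (ξ : Fin n → K) (j : Fin n)
    (g : MvPolynomial (Fin n) K) :
    expFunctional ξ (pderiv j g) = coproduct (X j - C (ξ j)) (expFunctional ξ g) := by
  have h : coproduct (X j - C (ξ j)) (expFunctional ξ g) =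
      coproduct (X j) (expFunctional ξ g) - ξ j • expFunctional ξ g := by
    refine LinearMap.ext fun q => ?_
    simp [sub_mul, C_mul']
  rw [h, expFunctional_apply ξ g, coproduct_X_functionalOf, Derivation.leibniz,
    pderiv_expSeries, MvPowerSeries.pderiv_coe, smul_eq_mul, smul_eq_mul, functionalOf_add,
    mul_smul_comm, functionalOf_smul, add_sub_cancel_left, mul_comm, expFunctional_apply]

theorem expFunctional_pderiv_pow [CharZero K] (ξ : Fin n → K) (j : Fin n) (m : ℕ)
    (g : MvPolynomial (Fin n) K) :
    expFunctional ξ (((pderiv j).toLinearMap ^ m : End K (MvPolynomial (Fin n) K)) g) =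
      coproduct ((X j - C (ξ j)) ^ m) (expFunctional ξ g) := by
  induction m with
  | zero => simp [coproduct_one]
  | succ m ih =>
    rw [pow_succ', pow_succ', coproduct_mul, ← ih, ← expFunctional_pderiv]
    rfl

theorem expFunctional_iterPDeriv [CharZero K] (ξ : Fin n → K) (α : Fin n →₀ ℕ)
    (g : MvPolynomial (Fin n) K) :
    expFunctional ξ (iterPDeriv α g) =
      coproduct (∏ i, (X i - C (ξ i)) ^ α i) (expFunctional ξ g) := by
  -- `iterPDeriv` is an ordered product of operators, so the induction is on the list of factors
  have key : ∀ l : List (Fin n), expFunctional ξ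
      ((l.map fun i => ((pderiv (R := K) i).toLinearMap ^ α i :
        End K (MvPolynomial (Fin n) K))).prod g) =
      coproduct (l.map fun i => (X i - C (ξ i)) ^ α i).prod (expFunctional ξ g) := by
    intro l
    induction l with
    | nil => simp [coproduct_one]
    | cons i l ih =>
      rw [List.map_cons, List.map_cons, List.prod_cons, List.prod_cons, coproduct_mul, ← ih,
        ← expFunctional_pderiv_pow]
      rfl
  rw [iterPDeriv, ← List.prod_ofFn, List.ofFn_eq_map, List.ofFn_eq_map]
  exact key _

/-- The translation `g(x) ↦ g(x - ξ)`. -/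
noncomputable def translate (ξ : Fin n → K) :
    MvPolynomial (Fin n) K →ₐ[K] MvPolynomial (Fin n) K :=
  aeval fun i => X i - C (ξ i)

theorem translate_surjective (ξ : Fin n → K) : Function.Surjective (translate ξ) := by
  intro p
  refine ⟨aeval (fun i => X i + C (ξ i)) p, ?_⟩
  rw [← AlgHom.comp_apply]
  have : (translate ξ).comp (aeval fun i => X i + C (ξ i)) = AlgHom.id K _ := by
    apply algHom_ext
    intro i
    simp [translate, algHom_C]
  rw [this, AlgHom.id_apply]

/-- The derivative `g(∂)` of the polynomial factor corresponds to the action of `g(x - ξ)`. -/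
theorem expFunctional_diffOp [CharZero K] (ξ : Fin n → K) (g p : MvPolynomial (Fin n) K) :
    expFunctional ξ (diffOp g p) = coproduct (translate ξ g) (expFunctional ξ p) := by
  rw [diffOp, map_sum, translate, aeval_def, eval₂_eq']
  refine LinearMap.ext fun q => ?_
  rw [LinearMap.sum_apply, coproduct_apply, Finset.sum_mul, map_sum]
  refine Finset.sum_congr rfl fun α _ => ?_
  rw [map_smul, expFunctional_iterPDeriv, LinearMap.smul_apply, coproduct_apply, mul_assoc,
    algebraMap_eq, C_mul', map_smul]

/-- The linear map `p ↦ p ⋆ Φ`. -/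
noncomputable def coproductMap (Φ : Dual K (MvPolynomial (Fin n) K)) :
    MvPolynomial (Fin n) K →ₗ[K] Dual K (MvPolynomial (Fin n) K) where
  toFun p := coproduct p Φ
  map_add' p q := LinearMap.ext fun _ => by simp [add_mul]
  map_smul' r p := LinearMap.ext fun _ => by simp

theorem rank_quotient_annIdeal (Φ : Dual K (MvPolynomial (Fin n) K)) :
    Module.rank K (MvPolynomial (Fin n) K ⧸ annIdeal Φ) =
      Module.rank K (coproductMap Φ).range :=
  -- the kernel of `p ↦ p ⋆ Φ` is `I_Φ` by definition
  LinearEquiv.rank_eq <|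
    (Submodule.Quotient.restrictScalarsEquiv K (annIdeal Φ)).symm.trans
      (coproductMap Φ).quotKerEquivRange

/-- The space `R ⋆ Φ` is the image of the inverse system of `p` when `Φ` has series
`p(z) e_ξ(z)`. -/
theorem range_coproductMap_expFunctional [CharZero K] (ξ : Fin n → K)
    (p : MvPolynomial (Fin n) K) :
    (coproductMap (expFunctional ξ p)).range = (invSystem p).map (expFunctional ξ) := by
  rw [invSystem, Submodule.map_span]
  apply le_antisymm
  · rintro _ ⟨q, rfl⟩
    obtain ⟨g, rfl⟩ := translate_surjective ξ q
    exact Submodule.subset_span ⟨_, ⟨g, rfl⟩, expFunctional_diffOp ξ g p⟩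
  · rw [Submodule.span_le]
    rintro _ ⟨_, ⟨g, rfl⟩, rfl⟩
    exact ⟨translate ξ g, (expFunctional_diffOp ξ g p).symm⟩

theorem rank_quotient_annIdeal_expFunctional [CharZero K] (ξ : Fin n → K)
    (p : MvPolynomial (Fin n) K) :
    Module.rank K (MvPolynomial (Fin n) K ⧸ annIdeal (expFunctional ξ p)) =
      Module.rank K (invSystem p) := by
  rw [rank_quotient_annIdeal, range_coproductMap_expFunctional]
  exact ((Submodule.equivMapOfInjective _ (expFunctional_injective ξ) _).rank_eq).symm

/-! ### Annihilators at distinct points -/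

theorem exists_pderiv_pow_eq_zero (j : Fin n) (g : MvPolynomial (Fin n) K) :
    ∃ m : ℕ, ((pderiv j).toLinearMap ^ m : End K (MvPolynomial (Fin n) K)) g = 0 := by
  -- the exponent may be enlarged, so that two of them have a common bound
  have mono : ∀ (p : MvPolynomial (Fin n) K) (m m' : ℕ), m ≤ m' →
      ((pderiv j).toLinearMap ^ m : End K (MvPolynomial (Fin n) K)) p = 0 →
      ((pderiv j).toLinearMap ^ m' : End K (MvPolynomial (Fin n) K)) p = 0 := by
    intro p m m' hm hp
    rw [← Nat.sub_add_cancel hm, pow_add, Module.End.mul_apply, hp, map_zero]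
  induction g using MvPolynomial.induction_on' with
  | monomial α r =>
    refine ⟨α j + 1, ?_⟩
    induction hα : α j generalizing α r with
    | zero => simp [pderiv_monomial, hα]
    | succ m ih =>
      rw [pow_succ, Module.End.mul_apply, Derivation.coeFn_coe, pderiv_monomial]
      exact ih _ _ (by simp [hα])
  | add p q hp hq =>
    obtain ⟨m, hm⟩ := hp
    obtain ⟨m', hm'⟩ := hq
    refine ⟨max m m', ?_⟩
    rw [map_add, mono p m _ (le_max_left _ _) hm, mono q m' _ (le_max_right _ _) hm', add_zero]

/-- The annihilator of `g(z) e_ξ(z)` is supported at `ξ`. -/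
theorem exists_sub_pow_mem_annIdeal [CharZero K] (ξ : Fin n → K) (g : MvPolynomial (Fin n) K)
    (j : Fin n) : ∃ m : ℕ, (X j - C (ξ j)) ^ m ∈ annIdeal (expFunctional ξ g) := by
  obtain ⟨m, hm⟩ := exists_pderiv_pow_eq_zero j g
  refine ⟨m, ?_⟩
  rw [mem_annIdeal, ← expFunctional_pderiv_pow, hm, map_zero]

theorem isCoprime_annIdeal_expFunctional [CharZero K] {ξ η : Fin n → K} (h : ξ ≠ η)
    (g p : MvPolynomial (Fin n) K) :
    IsCoprime (annIdeal (expFunctional ξ g)) (annIdeal (expFunctional η p)) := by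
  obtain ⟨j, hj⟩ := Function.ne_iff.1 h
  obtain ⟨m, hm⟩ := exists_sub_pow_mem_annIdeal ξ g j
  obtain ⟨m', hm'⟩ := exists_sub_pow_mem_annIdeal η p j
  have hcop : IsCoprime (X j - C (ξ j) : MvPolynomial (Fin n) K) (X j - C (η j)) := by
    refine ⟨-C (ξ j - η j)⁻¹, C (ξ j - η j)⁻¹, ?_⟩
    have : (C (ξ j - η j)⁻¹ * C (ξ j - η j) : MvPolynomial (Fin n) K) = 1 := by
      rw [← C_mul, inv_mul_cancel₀ (sub_ne_zero.2 hj), C_1]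
    rw [← this, C_sub]
    ring
  obtain ⟨u, v, huv⟩ := (hcop.pow (m := m) (n := m'))
  rw [Ideal.isCoprime_iff_exists]
  exact ⟨_, Ideal.mul_mem_left _ u hm, _, Ideal.mul_mem_left _ v hm', huv⟩

/-- If the annihilators of finitely many functionals are pairwise coprime, the annihilator of
their sum is the intersection of the annihilators. -/
theorem annIdeal_sum {σ : Type*} [Fintype σ] (Φ : σ → Dual K (MvPolynomial (Fin n) K))
    (h : Pairwise (Function.onFun IsCoprime fun i => annIdeal (Φ i))) :
    annIdeal (∑ i, Φ i) = ⨅ i, annIdeal (Φ i) := by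
  classical
  ext p
  rw [Ideal.mem_iInf]
  constructor
  · intro hp i
    -- `e` acts on the sum as the projection onto the summand `Φ i`
    obtain ⟨e, he⟩ := Ideal.exists_forall_sub_mem_ideal h (Pi.single i 1)
    rw [mem_annIdeal_iff] at hp ⊢
    intro q
    have h1 : ∀ j, Φ j (p * (e * q)) = if j = i then Φ i (p * q) else 0 := by
      intro j
      have h2 := mem_annIdeal_iff.1 (he j) (p * q)
      split_ifs with hji
      · subst hji
        rw [Pi.single_eq_same, sub_mul, one_mul, map_sub, sub_eq_zero] at h2
        rw [← h2, mul_left_comm]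
      · rw [Pi.single_eq_of_ne hji, sub_zero] at h2
        rw [← h2, mul_left_comm]
    have h3 := hp (e * q)
    rw [LinearMap.sum_apply, Finset.sum_congr rfl fun j _ => h1 j] at h3
    simpa using h3
  · intro hp
    rw [mem_annIdeal_iff]
    intro q
    rw [LinearMap.sum_apply]
    exact Finset.sum_eq_zero fun i _ => mem_annIdeal_iff.1 (hp i) q

/-- A form of `rank_pi` with a finite sum instead of `Cardinal.sum`. -/
theorem rank_pi_fin {s : ℕ} (M : Fin s → Type*) [∀ i, AddCommGroup (M i)]
    [∀ i, Module K (M i)] : Module.rank K (∀ i, M i) = ∑ i, Module.rank K (M i) := by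
  induction s with
  | zero => simp
  | succ s ih =>
    rw [← (Fin.consLinearEquiv K M).rank_eq, rank_prod', ih, Fin.sum_univ_succ]

theorem rank_quotient_iInf {s : ℕ} (I : Fin s → Ideal (MvPolynomial (Fin n) K))
    (h : Pairwise (Function.onFun IsCoprime I)) :
    Module.rank K (MvPolynomial (Fin n) K ⧸ ⨅ i, I i) =
      ∑ i, Module.rank K (MvPolynomial (Fin n) K ⧸ I i) := by
  let e := Ideal.quotientInfRingEquivPiQuotient I h
  have he : ∀ (r : K) x, e (r • x) = r • e x := by
    intro r x
    obtain ⟨p, rfl⟩ := Ideal.Quotient.mk_surjective x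
    rfl
  let e' : (MvPolynomial (Fin n) K ⧸ ⨅ i, I i) ≃ₗ[K] ∀ i, MvPolynomial (Fin n) K ⧸ I i :=
    { e with map_smul' := he }
  rw [e'.rank_eq, rank_pi_fin]

theorem gadFunctional_eq_sum {s : ℕ} (d : ℕ) (k : Fin s → ℕ)
    (ω : Fin s → MvPolynomial (Fin (n + 1)) K) (ξ : Fin s → Fin (n + 1) → K) :
    gadFunctional d k ω ξ =
      ∑ i, expFunctional (fun j => ξ i j.succ) (affinePart d (k i) (ξ i) (ω i)) := by
  let F : MvPowerSeries (Fin n) K →+ Dual K (MvPolynomial (Fin n) K) :=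
    AddMonoidHom.mk' functionalOf functionalOf_add
  exact map_sum F _ _

end Functional

/-! ### Apolarity and the functional of a decomposition -/

section Comparison

variable {K : Type*} [Field K] {n : ℕ}

theorem apolar_monomial {m : ℕ} (f : MvPolynomial (Fin m) K) (α : Fin m →₀ ℕ) (r : K) :
    apolar f (monomial α r) = ((α.multinomial : ℕ) : K)⁻¹ * coeff α f * r := by
  rw [apolar, Finset.sum_eq_single α]
  · rw [coeff_monomial, if_pos rfl]
  · intro β _ h
    rw [coeff_monomial, if_neg h.symm, mul_zero]
  · intro h
    rw [notMem_support_iff.1 h, mul_zero, zero_mul]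

theorem homogenizeAux_monomial (d : ℕ) (β : Fin n →₀ ℕ) (r : K) :
    homogenizeAux K n d (monomial β r) = monomial (Finsupp.cons (d - β.degree) β) r := by
  have h : monomial β r = r • basisMonomials (Fin n) K β := by simp [smul_monomial]
  rw [h, map_smul, homogenizeAux, Basis.constr_basis, smul_monomial, smul_eq_mul, mul_one]

theorem prod_factorial_mul_multinomial {m : ℕ} (α : Fin m →₀ ℕ) :
    (∏ i, (α i)!) * α.multinomial = α.degree ! := by
  rw [Finsupp.multinomial_eq_of_support_subset (Finset.subset_univ _), Nat.multinomial_spec,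
    Finsupp.degree_eq_sum]

theorem coeff_linearForm_pow [CharZero K] {m : ℕ} (ξ : Fin m → K) (α : Fin m →₀ ℕ) :
    coeff α (linearForm ξ ^ α.degree) =
      (α.degree ! : K) * MvPowerSeries.coeff α (expSeries ξ) := by
  have h : linearForm ξ = ∑ i, ξ i • X i := by simp [linearForm, smul_eq_C_mul]
  have h0 : ((∏ i, (α i)! : ℕ) : K) ≠ 0 :=
    Nat.cast_ne_zero.2 (Finset.prod_ne_zero_iff.2 fun i _ => (α i).factorial_ne_zero)
  rw [h, coeff_linearCombination_X_pow_of_fintype, if_pos (by simp [Finsupp.degree_apply,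
    Finsupp.sum]), coeff_expSeries, ← prod_factorial_mul_multinomial,
    Finsupp.prod_fintype _ _ fun _ => pow_zero _]
  rw [Nat.cast_mul]
  field_simp

/-- The powers of a linear form are, up to factorials, the homogeneous parts of `e_ξ`. So in degree
`|β|` the product of a form `q` with `e_ξ` only involves one such power. -/
theorem coeff_mul_linearForm_pow [CharZero K] {j : ℕ} (q : MvPolynomial (Fin n) K)
    (hq : q.IsHomogeneous j) (ξ : Fin n → K) (β : Fin n →₀ ℕ) :
    coeff β (q * linearForm ξ ^ (β.degree - j)) =
      ((β.degree - j)! : K) *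
        MvPowerSeries.coeff β ((q : MvPowerSeries (Fin n) K) * expSeries ξ) := by
  classical
  rw [coeff_mul, MvPowerSeries.coeff_mul, Finset.mul_sum]
  refine Finset.sum_congr rfl fun x hx => ?_
  rw [Finset.HasAntidiagonal.mem_antidiagonal] at hx
  by_cases h0 : coeff x.1 q = 0
  · simp [h0]
  have h1 : x.1.degree = j := by rw [Finsupp.degree_eq_weight_one]; exact hq h0
  have h2 : β.degree - j = x.2.degree := by
    rw [← hx, map_add, h1, Nat.add_sub_cancel_left]
  rw [h2, coeff_linearForm_pow, MvPolynomial.coeff_coe, mul_left_comm]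

theorem coeff_mul_expSeries_of_degree_lt {j : ℕ} (q : MvPolynomial (Fin n) K)
    (hq : q.IsHomogeneous j) (ξ : Fin n → K) (β : Fin n →₀ ℕ) (hj : β.degree < j) :
    MvPowerSeries.coeff β ((q : MvPowerSeries (Fin n) K) * expSeries ξ) = 0 := by
  classical
  rw [MvPowerSeries.coeff_mul]
  refine Finset.sum_eq_zero fun x hx => ?_
  rw [Finset.HasAntidiagonal.mem_antidiagonal] at hx
  have h0 : coeff x.1 q = 0 := by
    by_contra h0
    have h1 : x.1.degree = j := by rw [Finsupp.degree_eq_weight_one]; exact hq h0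
    have h2 := congrArg Finsupp.degree hx
    rw [map_add] at h2
    omega
  rw [MvPolynomial.coeff_coe, h0, zero_mul]

theorem coeff_cons_rename_mul_linearForm_pow (q : MvPolynomial (Fin n) K)
    (ξ : Fin (n + 1) → K) (hξ : ξ 0 = 1) (m e : ℕ) (β : Fin n →₀ ℕ) :
    coeff (Finsupp.cons m β) (rename Fin.succ q * linearForm ξ ^ e) =
      coeff β (q * linearForm (fun i => ξ i.succ) ^ (e - m)) * (e.choose m : K) := by
  have h1 : tailForm ξ = rename Fin.succ (linearForm fun i : Fin n => ξ i.succ) := by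
    simp [tailForm, linearForm]
  rw [← finSuccEquiv_coeff_coeff, map_mul, map_pow, linearForm_eq, hξ, C_1, one_mul, map_add, h1,
    finSuccEquiv_X_zero, finSuccEquiv_rename_succ, finSuccEquiv_rename_succ,
    Polynomial.coeff_C_mul, Polynomial.coeff_X_add_C_pow, ← mul_assoc, ← C_eq_coe_nat,
    mul_comm _ (C _), coeff_C_mul, mul_comm]

/-- The apolar product of `q ℓ^(d - j)` with a monomial of degree `d` is, up to the factor
`(d - j)! / d!`, the value of the functional `q(z) e_ξ(z)` on the dehomogenized monomial. -/
theorem apolar_rename_mul_linearForm_pow [CharZero K] {d j : ℕ}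
    (q : MvPolynomial (Fin n) K) (hq : q.IsHomogeneous j) (ξ : Fin (n + 1) → K)
    (hξ : ξ 0 = 1) (hj : j ≤ d) (β : Fin n →₀ ℕ) (hβ : β.degree ≤ d) :
    (((Finsupp.cons (d - β.degree) β).multinomial : ℕ) : K)⁻¹ *
        coeff (Finsupp.cons (d - β.degree) β) (rename Fin.succ q * linearForm ξ ^ (d - j)) =
      (d ! : K)⁻¹ * (((d - j)! : K) *
        expFunctional (fun i => ξ i.succ) q (monomial β 1)) := by
  rw [coeff_cons_rename_mul_linearForm_pow q ξ hξ, expFunctional_apply, functionalOf_monomial]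
  rcases lt_or_ge β.degree j with h | h
  -- here both sides vanish, the left one because `d - j < d - |β|`
  · rw [coeff_mul_expSeries_of_degree_lt q hq _ β h]
    rw [Nat.choose_eq_zero_of_lt (by omega)]
    simp
  · have h1 : d - j - (d - β.degree) = β.degree - j := by omega
    rw [h1, coeff_mul_linearForm_pow q hq _ β]
    have h2 : (d - β.degree)! * (∏ i, (β i)!) * (Finsupp.cons (d - β.degree) β).multinomial =
        d ! := by
      have := prod_factorial_mul_multinomial (Finsupp.cons (d - β.degree) β)
      rw [Fin.prod_univ_succ, Finsupp.degree_eq_sum (Finsupp.cons _ _), Fin.sum_univ_succ] at this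
      simp only [Finsupp.cons_zero, Finsupp.cons_succ] at this
      rw [this, ← Finsupp.degree_eq_sum, Nat.sub_add_cancel hβ]
    have h3 := Nat.choose_mul_factorial_mul_factorial (n := d - j) (k := d - β.degree) (by omega)
    rw [h1] at h3
    have h4 : (((Finsupp.cons (d - β.degree) β).multinomial : ℕ) : K) ≠ 0 := by
      intro h0
      rw [Nat.cast_eq_zero] at h0
      rw [h0, mul_zero] at h2
      exact d.factorial_ne_zero h2.symm
    have h5 : (d ! : K) ≠ 0 := Nat.cast_ne_zero.2 d.factorial_ne_zero
    have h2' := congrArg (Nat.cast (R := K)) h2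
    have h3' := congrArg (Nat.cast (R := K)) h3
    simp only [Nat.cast_mul] at h2' h3'
    rw [← h3']
    field_simp
    rw [← h2']
    ring

/-- The functional `f̌` is the restriction to `R_{≤ d}` of the functional of any decomposition
of `f`. -/
theorem fcheck_eq_gadFunctional [CharZero K] {d s : ℕ} {f : forms K n d} {k : Fin s → ℕ}
    {ω : Fin s → MvPolynomial (Fin (n + 1)) K} {ξ : Fin s → Fin (n + 1) → K}
    (hgad : IsGAD f k ω ξ) (hξ : ∀ i, ξ i 0 = 1) (p : degLE K n d) :
    fcheck f p = gadFunctional d k ω ξ p := by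
  have hmono : ∀ β : Fin n →₀ ℕ, β.degree ≤ d →
      (((Finsupp.cons (d - β.degree) β).multinomial : ℕ) : K)⁻¹ *
        coeff (Finsupp.cons (d - β.degree) β) (f : MvPolynomial (Fin (n + 1)) K) =
      gadFunctional d k ω ξ (monomial β 1) := by
    intro β hβ
    rw [hgad.eq_sum, coeff_sum, Finset.mul_sum, gadFunctional_eq_sum, LinearMap.sum_apply]
    refine Finset.sum_congr rfl fun i _ => ?_
    obtain ⟨hpart, hω⟩ := part_spec (ξ i) (by simp [hξ]) (ω i) (hgad.homogeneous i)
    have hk := hgad.le i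
    conv_lhs => rw [hω]
    rw [Finset.sum_mul, coeff_sum, Finset.mul_sum, affinePart, map_smul, map_sum,
      LinearMap.smul_apply, LinearMap.sum_apply, smul_eq_mul, Finset.mul_sum]
    refine Finset.sum_congr rfl fun j hj => ?_
    rw [Finset.mem_range] at hj
    have hexp : k i - j + (d - k i) = d - j := by omega
    rw [mul_assoc, ← pow_add, hexp,
      apolar_rename_mul_linearForm_pow _ (hpart j (by omega)) _ (hξ i) (by omega) β hβ, map_smul,
      LinearMap.smul_apply, smul_eq_mul]
  have hp := p.2
  rw [mem_restrictTotalDegree] at hp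
  -- both functionals are linear, so they are compared on the monomials of `p`
  have h1 : fcheck f p = ∑ β ∈ (p : MvPolynomial (Fin n) K).support,
      coeff β (p : MvPolynomial (Fin n) K) *
        ((((Finsupp.cons (d - β.degree) β).multinomial : ℕ) : K)⁻¹ *
        coeff (Finsupp.cons (d - β.degree) β) (f : MvPolynomial (Fin (n + 1)) K)) := by
    let A : MvPolynomial (Fin (n + 1)) K →+ K :=
      AddMonoidHom.mk' (apolar (f : MvPolynomial (Fin (n + 1)) K)) fun g h => by
        simp [apolar, mul_add, Finset.sum_add_distrib]
    have h2 : fcheck f p = A (homogenizeAux K n d p) := rfl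
    rw [h2]
    conv_lhs => rw [(p : MvPolynomial (Fin n) K).as_sum, map_sum, map_sum]
    refine Finset.sum_congr rfl fun β _ => ?_
    rw [homogenizeAux_monomial]
    refine (apolar_monomial _ _ _).trans (mul_comm _ _)
  rw [h1]
  conv_rhs => rw [(p : MvPolynomial (Fin n) K).as_sum, map_sum]
  refine Finset.sum_congr rfl fun β hβ => ?_
  have h3 : β.degree ≤ d := by
    refine le_trans ?_ hp
    simpa [Finsupp.degree_apply, Finsupp.sum] using le_totalDegree hβ
  have h4 : monomial β (coeff β (p : MvPolynomial (Fin n) K)) =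
      coeff β (p : MvPolynomial (Fin n) K) • monomial β (1 : K) := by
    rw [smul_monomial, smul_eq_mul, mul_one]
  rw [hmono β h3, h4, map_smul, smul_eq_mul]

end Comparison

/-! ### The duality pairing on the quotient algebra -/

section Pairing

variable {K : Type*} [Field K] {n : ℕ}

/-- The functional on `R / I_Φ` induced by `Φ`. -/
noncomputable def quotientFunctional (Φ : Dual K (MvPolynomial (Fin n) K)) :
    Dual K (MvPolynomial (Fin n) K ⧸ annIdeal Φ) :=
  ((annIdeal Φ).restrictScalars K).liftQ Φ (fun p hp => by
      have := mem_annIdeal_iff.1 hp 1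
      rwa [mul_one] at this) ∘ₗ
    (Submodule.Quotient.restrictScalarsEquiv K (annIdeal Φ)).symm.toLinearMap

/-- The bilinear form `(p, q) ↦ Φ(p q)` on `R / I_Φ`. -/
noncomputable def pairing (Φ : Dual K (MvPolynomial (Fin n) K)) :
    (MvPolynomial (Fin n) K ⧸ annIdeal Φ) →ₗ[K] Dual K (MvPolynomial (Fin n) K ⧸ annIdeal Φ) :=
  (LinearMap.mul K _).compr₂ (quotientFunctional Φ)

/-- The quotient map `R → R / I` as a `K`-linear map. -/
noncomputable def quotientMap (I : Ideal (MvPolynomial (Fin n) K)) :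
    MvPolynomial (Fin n) K →ₗ[K] MvPolynomial (Fin n) K ⧸ I :=
  (Ideal.Quotient.mkₐ K I).toLinearMap

theorem ker_quotientMap (I : Ideal (MvPolynomial (Fin n) K)) :
    (quotientMap I).ker = I.restrictScalars K := by
  ext p
  exact Ideal.Quotient.eq_zero_iff_mem

theorem range_dualMap_quotientMap (I : Ideal (MvPolynomial (Fin n) K)) :
    (quotientMap I).dualMap.range = perp I := by
  rw [LinearMap.range_dualMap_eq_dualAnnihilator_ker, ker_quotientMap, perp]

theorem pairing_mk (Φ : Dual K (MvPolynomial (Fin n) K)) (p q : MvPolynomial (Fin n) K) :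
    pairing Φ (Ideal.Quotient.mk _ p) (Ideal.Quotient.mk _ q) = Φ (p * q) := rfl

theorem pairing_injective (Φ : Dual K (MvPolynomial (Fin n) K)) :
    Function.Injective (pairing Φ) := by
  rw [← LinearMap.ker_eq_bot, LinearMap.ker_eq_bot']
  intro x hx
  obtain ⟨p, rfl⟩ := Ideal.Quotient.mk_surjective x
  rw [Ideal.Quotient.eq_zero_iff_mem, mem_annIdeal_iff]
  intro q
  rw [← pairing_mk, hx, LinearMap.zero_apply]

/-- If `R / I_Φ` is finite-dimensional, the pairing identifies it with its dual. -/
noncomputable def pairingEquiv (Φ : Dual K (MvPolynomial (Fin n) K))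
    [FiniteDimensional K (MvPolynomial (Fin n) K ⧸ annIdeal Φ)] :
    (MvPolynomial (Fin n) K ⧸ annIdeal Φ) ≃ₗ[K] Dual K (MvPolynomial (Fin n) K ⧸ annIdeal Φ) :=
  LinearEquiv.ofInjectiveOfFinrankEq (pairing Φ) (pairing_injective Φ)
    Subspace.dual_finrank_eq.symm

theorem IsBasisMod.basis_apply {I : Ideal (MvPolynomial (Fin n) K)} {ι : Type*}
    {b : ι → MvPolynomial (Fin n) K} (h : IsBasisMod I b) (j : ι) :
    h.basis j = Ideal.Quotient.mk I (b j) := by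
  rw [IsBasisMod.basis, Basis.mk_apply]

/-- A subspace containing representatives of a basis surjects onto the quotient. -/
theorem IsBasisMod.quotientMap_domRestrict_surjective {I : Ideal (MvPolynomial (Fin n) K)}
    {ι : Type*} {b : ι → MvPolynomial (Fin n) K} (h : IsBasisMod I b)
    {V : Submodule K (MvPolynomial (Fin n) K)} (hV : Set.range b ⊆ V) :
    Function.Surjective (quotientMap I ∘ₗ V.subtype) := by
  rw [← LinearMap.range_eq_top, ← top_le_iff, ← h.2, Submodule.span_le]
  rintro _ ⟨j, rfl⟩
  exact ⟨⟨b j, hV ⟨j, rfl⟩⟩, rfl⟩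

/-- If `B ∋ 1` represents a basis of `R / I`, the ideal `I` is generated by its elements in
any subspace containing `B⁺`: modulo these elements, the span of `B` is stable under
multiplication by the variables. -/
theorem IsBasisMod.span_inf_eq {I : Ideal (MvPolynomial (Fin n) K)} {ι : Type*}
    {b : ι → MvPolynomial (Fin n) K} (h : IsBasisMod I b) (h1 : 1 ∈ Set.range b)
    {V : Submodule K (MvPolynomial (Fin n) K)} (hV : plus (Set.range b) ⊆ V) :
    Ideal.span ((I.restrictScalars K ⊓ V : Submodule K _) : Set (MvPolynomial (Fin n) K)) = I := by
  set J := Ideal.span ((I.restrictScalars K ⊓ V : Submodule K _) : Set (MvPolynomial (Fin n) K))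
    with hJ
  set S := Submodule.span K (Set.range b)
  have hJI : J ≤ I := Ideal.span_le.2 fun p hp => hp.1
  have hbV : S ≤ V := Submodule.span_le.2 fun p hp => hV (subset_plus hp)
  -- every polynomial is congruent to an element of the span of `B`
  have hred : ∀ p, ∃ q ∈ S, p - q ∈ I := by
    intro p
    obtain ⟨⟨q, hq⟩, hqp⟩ := h.quotientMap_domRestrict_surjective (V := S)
      Submodule.subset_span (quotientMap I p)
    exact ⟨q, hq, Ideal.Quotient.eq.1 hqp.symm⟩
  have hXV : ∀ i, ∀ p ∈ S, X i * p ∈ V := by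
    intro i p hp
    have : S ≤ V.comap (LinearMap.mulLeft K (X i)) :=
      Submodule.span_le.2 fun q hq => hV (X_mul_mem_plus hq i)
    exact this hp
  have hSJ : ∀ p, p ∈ S ⊔ J.restrictScalars K := by
    intro p
    induction p using MvPolynomial.induction_on with
    | C r =>
      refine Submodule.mem_sup_left ?_
      rw [← mul_one (C r), C_mul']
      exact S.smul_mem _ (Submodule.subset_span h1)
    | add p q hp hq => exact add_mem hp hq
    | mul_X p i hp =>
      obtain ⟨q, hq, t, ht, rfl⟩ := Submodule.mem_sup.1 hp
      obtain ⟨q', hq', hqq'⟩ := hred (X i * q)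
      refine Submodule.mem_sup.2 ⟨q', hq', (X i * q - q') + X i * t, ?_, by ring⟩
      exact J.add_mem (Ideal.subset_span ⟨hqq', V.sub_mem (hXV i q hq) (hbV hq')⟩)
        (J.mul_mem_left _ ht)
  refine le_antisymm hJI fun p hp => ?_
  obtain ⟨q, hq, t, ht, rfl⟩ := Submodule.mem_sup.1 (hSJ p)
  have hqI : q ∈ I := by simpa using I.sub_mem hp (hJI ht)
  exact J.add_mem (Ideal.subset_span ⟨hqI, hbV hq⟩) ht

end Pairing

/-! ### Truncated Hankel operators of a functional with a known extension -/

section Hankel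

variable {K : Type*} [Field K] {n c d : ℕ} {Φ : Dual K (MvPolynomial (Fin n) K)}
  {Ψ : Dual K (degLE K n d)}

/-- When `Ψ` is the restriction of `Φ`, the truncated Hankel operator factors through the
pairing on `R / I_Φ`. -/
theorem hankel_eq_comp (hΨ : ∀ p : degLE K n d, Ψ p = Φ p) (hc : c ≤ d)
    (W V : Submodule K (MvPolynomial (Fin n) K)) (hW : W ≤ degLE K n (d - c))
    (hV : V ≤ degLE K n c) :
    hankel hc Ψ W V hW hV = (quotientMap (annIdeal Φ) ∘ₗ W.subtype).dualMap ∘ₗ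
      pairing Φ ∘ₗ quotientMap (annIdeal Φ) ∘ₗ V.subtype := by
  refine LinearMap.ext fun p => LinearMap.ext fun q => ?_
  exact hΨ _

theorem toMatrix_hankel (hc : c ≤ d) {κ κ' : Type*} [Fintype κ] [DecidableEq κ] [Fintype κ']
    [DecidableEq κ'] {a : κ → MvPolynomial (Fin n) K} {a' : κ' → MvPolynomial (Fin n) K}
    (ha : LinearIndependent K a) (ha' : LinearIndependent K a')
    (hA : Submodule.span K (Set.range a) ≤ degLE K n c)
    (hA' : Submodule.span K (Set.range a') ≤ degLE K n (d - c)) :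
    LinearMap.toMatrix (Basis.span ha) (Basis.span ha').dualBasis
        (hankel hc Ψ _ _ hA' hA) =
      hankelMatrix hc Ψ a' a (fun i => hA' (Submodule.subset_span ⟨i, rfl⟩))
        (fun j => hA (Submodule.subset_span ⟨j, rfl⟩)) := by
  ext i j
  rw [LinearMap.toMatrix_apply, Basis.dualBasis_repr]
  simp [hankel, hankelMatrix, Basis.span_apply]

theorem rank_hankelMatrix (hc : c ≤ d) {κ κ' : Type*} [Fintype κ] [Fintype κ']
    {a : κ → MvPolynomial (Fin n) K} {a' : κ' → MvPolynomial (Fin n) K}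
    (ha : LinearIndependent K a) (ha' : LinearIndependent K a')
    (hA : Submodule.span K (Set.range a) ≤ degLE K n c)
    (hA' : Submodule.span K (Set.range a') ≤ degLE K n (d - c)) :
    (hankelMatrix hc Ψ a' a (fun i => hA' (Submodule.subset_span ⟨i, rfl⟩))
        (fun j => hA (Submodule.subset_span ⟨j, rfl⟩))).rank =
      finrank K (hankel hc Ψ _ _ hA' hA).range := by
  classical
  rw [← toMatrix_hankel hc ha ha' hA hA',
    Matrix.rank_eq_finrank_range_toLin _ (Basis.span ha').dualBasis (Basis.span ha),
    Matrix.toLin_toMatrix]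

end Hankel

/-! ### Matrices, kernel and image of the Hankel operator -/

section Main

variable {K : Type*} [Field K] {n c d : ℕ} {Φ : Dual K (MvPolynomial (Fin n) K)}
  {Ψ : Dual K (degLE K n d)}

/-- `H₀` is the matrix of the pairing isomorphism in the bases `B` and the dual of `B'`, and `Hᵢ`
is the matrix of its composition with multiplication by `xᵢ`. -/
theorem exists_inverse_hankelMatrix (hΨ : ∀ p : degLE K n d, Ψ p = Φ p) (hc : c ≤ d)
    {ι ι' : Type*} [Fintype ι] [DecidableEq ι] [Fintype ι'] [DecidableEq ι']
    {b : ι → MvPolynomial (Fin n) K} {b' : ι' → MvPolynomial (Fin n) K}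
    (hb : IsBasisMod (annIdeal Φ) b) (hb' : IsBasisMod (annIdeal Φ) b')
    (hbc : ∀ j, b j ∈ degLE K n c) (hbX : ∀ (i : Fin n) j, X i * b j ∈ degLE K n c)
    (hbc' : ∀ j, b' j ∈ degLE K n (d - c)) :
    ∃ G : Matrix ι ι' K, G * hankelMatrix hc Ψ b' b hbc' hbc = 1 ∧
      hankelMatrix hc Ψ b' b hbc' hbc * G = 1 ∧
      ∀ i : Fin n, LinearMap.toMatrix hb.basis hb.basis (multOp (annIdeal Φ) (X i)) =
        G * hankelMatrix hc Ψ b' (fun j => X i * b j) hbc' (hbX i) := by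
  have : FiniteDimensional K (MvPolynomial (Fin n) K ⧸ annIdeal Φ) :=
    Module.Finite.of_basis hb.basis
  let e := pairingEquiv Φ
  have hH : hankelMatrix hc Ψ b' b hbc' hbc =
      LinearMap.toMatrix hb.basis hb'.basis.dualBasis e.toLinearMap := by
    ext i j
    rw [LinearMap.toMatrix_apply, Basis.dualBasis_repr, hb.basis_apply, hb'.basis_apply]
    exact hΨ _
  have hX : ∀ i : Fin n, hankelMatrix hc Ψ b' (fun j => X i * b j) hbc' (hbX i) =
      LinearMap.toMatrix hb.basis hb'.basis.dualBasis
        (e.toLinearMap ∘ₗ multOp (annIdeal Φ) (X i)) := by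
    intro i
    ext k j
    rw [LinearMap.toMatrix_apply, Basis.dualBasis_repr, hb.basis_apply, hb'.basis_apply]
    exact hΨ _
  refine ⟨LinearMap.toMatrix hb'.basis.dualBasis hb.basis e.symm.toLinearMap, ?_, ?_, ?_⟩
  · rw [hH, ← LinearMap.toMatrix_comp, LinearEquiv.symm_comp, LinearMap.toMatrix_id]
  · rw [hH, ← LinearMap.toMatrix_comp, LinearEquiv.comp_symm, LinearMap.toMatrix_id]
  · intro i
    rw [hX, ← LinearMap.toMatrix_comp, ← LinearMap.comp_assoc, LinearEquiv.symm_comp,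
      LinearMap.id_comp]

theorem map_ker_hankel (hΨ : ∀ p : degLE K n d, Ψ p = Φ p) (hc : c ≤ d)
    {W V : Submodule K (MvPolynomial (Fin n) K)} (hW : W ≤ degLE K n (d - c))
    (hV : V ≤ degLE K n c)
    (hWs : Function.Surjective (quotientMap (annIdeal Φ) ∘ₗ W.subtype)) :
    (hankel hc Ψ W V hW hV).ker.map V.subtype = (annIdeal Φ).restrictScalars K ⊓ V := by
  rw [hankel_eq_comp hΨ, ← LinearMap.comp_assoc, LinearMap.ker_comp_of_ker_eq_bot,
    LinearMap.ker_comp, ker_quotientMap, Submodule.map_comap_subtype, inf_comm]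
  rw [LinearMap.ker_eq_bot]
  exact (LinearMap.dualMap_injective_of_surjective hWs).comp (pairing_injective Φ)

theorem range_hankel (hΨ : ∀ p : degLE K n d, Ψ p = Φ p) (hc : c ≤ d)
    [FiniteDimensional K (MvPolynomial (Fin n) K ⧸ annIdeal Φ)]
    {W V : Submodule K (MvPolynomial (Fin n) K)} (hW : W ≤ degLE K n (d - c))
    (hV : V ≤ degLE K n c)
    (hVs : Function.Surjective (quotientMap (annIdeal Φ) ∘ₗ V.subtype)) :
    (hankel hc Ψ W V hW hV).range = (quotientMap (annIdeal Φ) ∘ₗ W.subtype).dualMap.range := by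
  rw [hankel_eq_comp hΨ]
  apply LinearMap.range_comp_of_range_eq_top
  rw [LinearMap.range_eq_top]
  exact (pairingEquiv Φ).surjective.comp hVs

theorem range_dualMap_quotientMap_subtype (I : Ideal (MvPolynomial (Fin n) K))
    (W : Submodule K (MvPolynomial (Fin n) K)) :
    (quotientMap I ∘ₗ W.subtype).dualMap.range = (perp I).map W.dualRestrict := by
  rw [← range_dualMap_quotientMap, ← LinearMap.range_comp]
  rfl

/-- The dimension of `A_Φ` is the sum of the dimensions of the inverse systems. -/
theorem rank_quotient_annIdeal_gadFunctional [CharZero K] {d s : ℕ} {f : forms K n d}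
    {k : Fin s → ℕ} {ω : Fin s → MvPolynomial (Fin (n + 1)) K} {ξ : Fin s → Fin (n + 1) → K}
    (hgad : IsGAD f k ω ξ) (hξ : ∀ i, ξ i 0 = 1) :
    Module.rank K (MvPolynomial (Fin n) K ⧸ annIdeal (gadFunctional d k ω ξ)) =
      ∑ i, Module.rank K (invSystem (affinePart d (k i) (ξ i) (ω i))) := by
  -- non-proportional forms `x₀ + ⋯` have distinct points
  have hcop : Pairwise (Function.onFun IsCoprime fun i => annIdeal
      (expFunctional (fun j => ξ i j.succ) (affinePart d (k i) (ξ i) (ω i)))) := by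
    intro i j hij
    refine isCoprime_annIdeal_expFunctional (fun h => ?_) _ _
    have h2 : ξ i = ξ j := by
      funext l
      refine Fin.cases ?_ (fun l => ?_) l
      · rw [hξ, hξ]
      · exact congrFun h l
    have h3 := (hgad.not_proportional i j hij).injective.ne (zero_ne_one (α := Fin 2))
    simp [h2] at h3
  rw [gadFunctional_eq_sum, annIdeal_sum _ hcop, rank_quotient_iInf _ hcop]
  exact Finset.sum_congr rfl fun i _ => rank_quotient_annIdeal_expFunctional _ _

end Main

end GAD

open GAD

theorem mainTheorem3 {K : Type*} [Field K] [CharZero K] {n d s c : ℕ}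
    -- a form with a generalized additive decomposition whose supports are `ℓᵢ = x₀ + ⋯`
    (f : forms K n d) (k : Fin s → ℕ) (ω : Fin s → MvPolynomial (Fin (n + 1)) K)
    (ξ : Fin s → Fin (n + 1) → K) (hgad : IsGAD f k ω ξ) (hξ : ∀ i, ξ i 0 = 1)
    -- the bases `B = {b j}`, `B' = {b' j}` of `A_Φ` and the sets `A = {a j}`, `A' = {a' j}`
    {ι ι' κ κ' : Type*} [Fintype ι] [DecidableEq ι] [Fintype ι'] [DecidableEq ι']
    [Fintype κ] [Fintype κ']
    (b : ι → MvPolynomial (Fin n) K) (b' : ι' → MvPolynomial (Fin n) K)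
    (a : κ → MvPolynomial (Fin n) K) (a' : κ' → MvPolynomial (Fin n) K)
    (hb : IsBasisMod (annIdeal (gadFunctional d k ω ξ)) b)
    (hb' : IsBasisMod (annIdeal (gadFunctional d k ω ξ)) b')
    (h1 : 1 ∈ Set.range b)
    (hc : c ≤ d)
    (ha : LinearIndependent K a) (ha' : LinearIndependent K a')
    (hBA : plus (Set.range b) ⊆ Submodule.span K (Set.range a))
    (hAc : Submodule.span K (Set.range a) ≤ degLE K n c)
    (hBA' : Set.range b' ⊆ Submodule.span K (Set.range a'))
    (hAc' : Submodule.span K (Set.range a') ≤ degLE K n (d - c)) :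
    let Φ := gadFunctional d k ω ξ
    let V := Submodule.span K (Set.range a)
    let W := Submodule.span K (Set.range a')
    -- the truncated Hankel operator and its matrix
    let HH := hankel hc (fcheck f) W V hAc' hAc
    let H := hankelMatrix hc (fcheck f) a' a
      (fun i => hAc' (Submodule.subset_span ⟨i, rfl⟩))
      (fun j => hAc (Submodule.subset_span ⟨j, rfl⟩))
    -- the matrices `H₀ = H^{B',B}` and `Hᵢ = H^{B',xᵢB}`
    let H₀ := hankelMatrix hc (fcheck f) b' b
      (fun i => hAc' (hBA' ⟨i, rfl⟩))
      (fun j => hAc (hBA (subset_plus (Set.mem_range_self j))))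
    let Hₓ := fun i : Fin n => hankelMatrix hc (fcheck f) b' (fun j => X i * b j)
      (fun i => hAc' (hBA' ⟨i, rfl⟩))
      (fun j => hAc (hBA (X_mul_mem_plus (Set.mem_range_self j) i)))
    -- `H₀` has a two-sided inverse `G`, and `G Hᵢ` is the matrix of multiplication by `xᵢ`
    (∃ G : Matrix ι ι' K, G * H₀ = 1 ∧ H₀ * G = 1 ∧
      ∀ i : Fin n,
        LinearMap.toMatrix hb.basis hb.basis (multOp (annIdeal Φ) (X i)) = G * Hₓ i) ∧
    -- the rank of `H`, as cardinal numbers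
    ((H.rank : Cardinal) = Module.rank K (MvPolynomial (Fin n) K ⧸ annIdeal Φ) ∧
      Module.rank K (MvPolynomial (Fin n) K ⧸ annIdeal Φ) =
        ∑ i, Module.rank K (invSystem (affinePart d (k i) (ξ i) (ω i)))) ∧
    -- kernel and image of the truncated Hankel operator
    (HH.ker.map V.subtype = (annIdeal Φ).restrictScalars K ⊓ V ∧
      Ideal.span (HH.ker.map V.subtype : Set (MvPolynomial (Fin n) K)) = annIdeal Φ ∧
      HH.range = (perp (annIdeal Φ)).map W.dualRestrict) := by
  intro Φ V W HH H H₀ Hₓ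
  have hΨ : ∀ p : degLE K n d, fcheck f p = Φ p := fcheck_eq_gadFunctional hgad hξ
  have : FiniteDimensional K (MvPolynomial (Fin n) K ⧸ annIdeal Φ) :=
    Module.Finite.of_basis hb.basis
  have hVs := hb.quotientMap_domRestrict_surjective (V := V) fun p hp => hBA (subset_plus hp)
  have hWs := hb'.quotientMap_domRestrict_surjective (V := W) hBA'
  have hker : HH.ker.map V.subtype = (annIdeal Φ).restrictScalars K ⊓ V :=
    map_ker_hankel hΨ hc hAc' hAc hWs
  have hrange := range_hankel hΨ hc (W := W) (V := V) hAc' hAc hVs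
  refine ⟨exists_inverse_hankelMatrix hΨ hc hb hb' _ _ _, ⟨?_, ?_⟩, hker, ?_, ?_⟩
  · rw [rank_hankelMatrix hc ha ha' hAc hAc', hrange,
      LinearMap.finrank_range_of_inj (LinearMap.dualMap_injective_of_surjective hWs),
      Subspace.dual_finrank_eq, Module.finrank_eq_rank]
  · exact rank_quotient_annIdeal_gadFunctional hgad hξ
  · rw [hker]
    exact hb.span_inf_eq h1 hBA
  · exact hrange.trans (range_dualMap_quotientMap_subtype _ W)
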